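/- Let $\mathscr{R}$ be a von Neumann algebra acting on a complex Hilbert space $\mathscr{H}$ (containing the identity operator $I$ of $\mathscr{H}$), and let $\mathfrak{H}$ be a Hilbert $\mathscr{R}$-bimodule: a right Hilbert $C^*$-module over $\mathscr{R}$ with a unital left action of $\mathscr{R}$ by adjointable operators, $\langle TA, B\rangle = \langle A, T^*B\rangle$, both actions being compatible with complex scalars. For $A_1, A_2 \in \mathfrak{H}$, the $\mathscr{R}$-segment joining $A_1$ and $A_2$ is the set $$\{\, T_1^*A_1T_1 + T_2^*A_2T_2 \;:\; T_1, T_2 \in \mathscr{R},\ T_1^*T_1 + T_2^*T_2 = I \,\}.$$ A subset $\mathscr{S} \subseteq \mathfrak{H}$ is called $\mathscr{R}$-convex if $\sum_{i=1}^n T_i^*A_iT_i \in \mathscr{S}$ for all $n \ge 1$, all $A_1, \dots, A_n \in \mathscr{S}$ and all $T_1, \dots, T_n \in \mathscr{R}$ with $\sum_{i=1}^n T_i^*T_i = I$. It is called pseudo $\mathscr{R}$-convex if, for any $A_1, A_2 \in \mathscr{S}$, the $\mathscr{R}$-segment joining $A_1$ and $A_2$ is contained in $\mathscr{S}$. Then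 a subset $\mathscr{S}$ of $\mathfrak{H}$ is $\mathscr{R}$-convex if and only if it is pseudo $\mathscr{R}$-convex. -/

import Mathlib

open scoped RightActions

namespace VonNeumannAlgebra

variable {H : Type*} [NormedAddCommGroup H] [InnerProductSpace ℂ H] [CompleteSpace H]

/-- A von Neumann algebra is closed under multiplication by complex scalars. -/
instance instSMulMemClassComplex : SMulMemClass (VonNeumannAlgebra H) ℂ (H →L[ℂ] H) where
  smul_mem {s} c _ hx := s.toStarSubalgebra.smul_mem hx c

/-- A von Neumann algebra is norm closed, so that it is itself a C⋆-algebra (through the instance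
for norm closed star subalgebras). -/
instance instIsClosed (R : VonNeumannAlgebra H) : IsClosed (R : Set (H →L[ℂ] H)) := by
  rw [← R.centralizer_centralizer]
  exact Set.isClosed_centralizer _

/-- The order that `R` inherits from the usual (Loewner) order of bounded operators is the order of
the C⋆-algebra `R`: the positive elements of `R` are the elements `star s * s` with `s` in `R`. -/
instance instStarOrderedRing (R : VonNeumannAlgebra H) : StarOrderedRing R := by
  refine StarOrderedRing.of_nonneg_iff' (fun {x y} h z => ?_) (fun x => ⟨fun hx => ?_, ?_⟩)
  · exact add_le_add_right (α := H →L[ℂ] H) h z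
  · have hx0 : (0 : H →L[ℂ] H) ≤ x := hx
    have hmem : CFC.sqrt (x : H →L[ℂ] H) ∈ R := by
      rw [← SetLike.mem_coe, ← R.centralizer_centralizer]
      intro g hg
      have hc : Commute (x : H →L[ℂ] H) g := hg _ x.2
      exact (hc.cfcₙ_nnreal _).symm
    refine ⟨⟨_, hmem⟩, Subtype.ext ?_⟩
    have hsa : star (CFC.sqrt (x : H →L[ℂ] H)) = CFC.sqrt (x : H →L[ℂ] H) :=
      (IsSelfAdjoint.of_nonneg (CFC.sqrt_nonneg _)).star_eq
    change (x : H →L[ℂ] H) = star (CFC.sqrt (x : H →L[ℂ] H)) * CFC.sqrt (x : H →L[ℂ] H)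
    rw [hsa, CFC.sqrt_mul_sqrt_self _ hx0]
  · rintro ⟨s, rfl⟩
    exact star_mul_self_nonneg (s : H →L[ℂ] H)

end VonNeumannAlgebra

/-- `HilbertBimodule A E`: the complex Banach space `E` is a Hilbert bimodule over the unital
C⋆-algebra `A`. The right `A`-action is, as usual in Mathlib, an action of `Aᵐᵒᵖ`; we write
`x <• a` for `x` multiplied by `a` on the right and `a •> x` for `x` multiplied by `a` on the left.

The inner product comes from `CStarModule Aᵐᵒᵖ E`; its values are read in `A` through
`MulOpposite.unop`. Its laws say that `⟪x, y⟫` is additive and `ℂ`-linear in `y`, that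
`⟪x, y <• a⟫ = ⟪x, y⟫ * a`, `star ⟪x, y⟫ = ⟪y, x⟫`, `0 ≤ ⟪x, x⟫` with equality only for `x = 0`,
and that `‖x‖ = √‖⟪x, x⟫‖`; so `E`, being complete, is a (right) Hilbert C⋆-module over `A`.
The left action commutes with the right one, and is by adjointable operators,
`⟪a •> x, y⟫ = ⟪x, star a •> y⟫`. Both actions are unital, and compatible with complex scalars. -/
class HilbertBimodule (A E : Type*) [CStarAlgebra A] [PartialOrder A] [StarOrderedRing A]
    [NormedAddCommGroup E] [NormedSpace ℂ E] [CompleteSpace E] [Module A E] [Module Aᵐᵒᵖ E]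
    extends CStarModule Aᵐᵒᵖ E, SMulCommClass A Aᵐᵒᵖ E where
  left_adjointable (a : A) (x y : E) :
    Inner.inner Aᵐᵒᵖ (a •> x) y = Inner.inner Aᵐᵒᵖ x (star a •> y)
  left_complex_smul (c : ℂ) (x : E) : (algebraMap ℂ A c) •> x = c • x
  right_complex_smul (c : ℂ) (x : E) : x <• (algebraMap ℂ A c) = c • x

section CStarConvexity

variable (A : Type*) {E : Type*} [CStarAlgebra A] [PartialOrder A] [StarOrderedRing A]
  [NormedAddCommGroup E] [NormedSpace ℂ E] [CompleteSpace E] [Module A E] [Module Aᵐᵒᵖ E]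
  [HilbertBimodule A E]

/-- The `A`-polytope generated by the tuple `x 0, …, x (n - 1)`: all sums `∑ i, Tᵢ* xᵢ Tᵢ` with
`T 0, …, T (n - 1)` in `A` such that `∑ i, Tᵢ* Tᵢ = 1`. -/
def cstarPolytope {n : ℕ} (x : Fin n → E) : Set E :=
  {y | ∃ T : Fin n → A, ∑ i, star (T i) * T i = 1 ∧ y = ∑ i, star (T i) •> x i <• T i}

/-- The `A`-segment joining `x` and `y`: the `A`-polytope generated by the pair `(x, y)`. -/
def cstarSegment (x y : E) : Set E :=
  cstarPolytope A ![x, y]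

/-- A set `S` is `A`-convex if it contains every `A`-convex combination `∑ i, Tᵢ* xᵢ Tᵢ` of finitely
many (at least one) elements `xᵢ` of `S`, where `Tᵢ ∈ A` and `∑ i, Tᵢ* Tᵢ = 1`. -/
def IsCStarConvex (S : Set E) : Prop :=
  ∀ n : ℕ, 1 ≤ n → ∀ x : Fin n → E, (∀ i, x i ∈ S) →
    ∀ T : Fin n → A, ∑ i, star (T i) * T i = 1 → ∑ i, star (T i) •> x i <• T i ∈ S

/-- A set `S` is pseudo `A`-convex if it contains the `A`-segment joining any two of its
elements. -/
def IsPseudoCStarConvex (S : Set E) : Prop :=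
  ∀ x ∈ S, ∀ y ∈ S, cstarSegment A x y ⊆ S

end CStarConvexity

/-!
An `A`-convex combination of two points is a point of an `A`-segment, so one direction is immediate.
For the converse, the first two terms of `∑ i, Tᵢ* xᵢ Tᵢ` are merged into one term, which lowers the
number of terms. If `T₀ = V X` and `T₁ = W X` with `V, W, X` in `R` and `V* V + W* W = 1`, then
`T₀* x₀ T₀ + T₁* x₁ T₁ = X* (V* x₀ V + W* x₁ W) X`, the point in parentheses lies on the segment
joining `x₀` and `x₁`, and `X* X = T₀* T₀ + T₁* T₁`. So all that is needed is the factorization of a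
column over `R` through an isometric column over `R`
(`VonNeumannAlgebra.exists_column_factorization`).

The polar decomposition `C = v |C|` of the column `C : H → H ⊕ H` with entries `T₀, T₁` is not
enough, because the partial isometry `v` need not extend to an isometry: it may map a proper
subspace of `H` onto `H ⊕ H`. But it suffices to find an isometric column `U` over `R` whose range contains the
range of `C`, for then `C = U (U* C)`. By the double commutant theorem (part of the definition of
a von Neumann algebra here), the columns over `R` are the operators `H → H ⊕ H` that intertwine the
natural actions of the commutant `R'`. Extend `v` by Zorn's lemma to a maximal intertwining partial
isometry `w` (`Intertwines.exists_maximal_isPartialIsometry`). By polar decomposition of the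
compressions `(1 - w w*) X (1 - w* w)`, maximality says that these vanish for all intertwiners `X`.
Finally apply the Schröder–Bernstein argument to `w` and the embedding `j : x ↦ (x, 0)`: with `M`
the closed span of the iterates of `ker w` under `w* j`, the operator `U` that equals `j` on `M` and `w`
on `Mᗮ` is an isometric intertwiner, and by maximality its range contains that of `w`
(`Intertwines.exists_isometry_of_maximal`).
-/

open scoped InnerProduct InnerProductSpace

/-! ### Intertwiners and partial isometries -/

section Intertwiners

variable {ι H K : Type*} [NormedAddCommGroup H] [InnerProductSpace ℂ H]
  [NormedAddCommGroup K] [InnerProductSpace ℂ K]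

/-- The operator `T : H → K` intertwines the families of operators `ρ` on `H` and `σ` on `K`. -/
def Intertwines (ρ : ι → H →L[ℂ] H) (σ : ι → K →L[ℂ] K) (T : H →L[ℂ] K) : Prop :=
  ∀ b x, T (ρ b x) = σ b (T x)

/-- A family of operators on `H` indexed by a type with a star operation is a star family if
it sends `star b` to the adjoint of the operator with index `b`. -/
def IsStarFamily [Star ι] [CompleteSpace H] (ρ : ι → H →L[ℂ] H) : Prop :=
  ∀ b, ρ (star b) = (ρ b)†

/-- `V` is a partial isometry: `V V* V = V`. -/
def IsPartialIsometry [CompleteSpace H] [CompleteSpace K] (V : H →L[ℂ] K) : Prop :=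
  ∀ x, V ((V†) (V x)) = V x

lemma Intertwines.adjoint [Star ι] [CompleteSpace H] [CompleteSpace K]
    {ρ : ι → H →L[ℂ] H} {σ : ι → K →L[ℂ] K} (hρ : IsStarFamily ρ) (hσ : IsStarFamily σ)
    {T : H →L[ℂ] K} (hT : Intertwines ρ σ T) : Intertwines σ ρ (T†) := by
  intro b y
  refine ext_inner_left ℂ fun z => ?_
  rw [ContinuousLinearMap.adjoint_inner_right, ← ContinuousLinearMap.adjoint_inner_left,
    ← hσ b, ← hT, ← ContinuousLinearMap.adjoint_inner_right, hρ b,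
    ContinuousLinearMap.adjoint_inner_left]

lemma IsPartialIsometry.adjoint [CompleteSpace H] [CompleteSpace K] {V : H →L[ℂ] K}
    (hV : IsPartialIsometry V) : IsPartialIsometry (V†) := by
  intro y
  refine ext_inner_left ℂ fun z => ?_
  rw [ContinuousLinearMap.adjoint_adjoint, ContinuousLinearMap.adjoint_inner_right,
    ← ContinuousLinearMap.adjoint_inner_left, ← ContinuousLinearMap.adjoint_inner_left,
    ContinuousLinearMap.adjoint_adjoint, hV, ContinuousLinearMap.adjoint_inner_right]

/-- The orthogonal projection onto an invariant closed subspace intertwines a star family with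
itself. -/
lemma intertwines_starProjection [Star ι] [CompleteSpace H] {ρ : ι → H →L[ℂ] H}
    (hρ : IsStarFamily ρ) (M : Submodule ℂ H) [M.HasOrthogonalProjection]
    (hM : ∀ b, ∀ x ∈ M, ρ b x ∈ M) : Intertwines ρ ρ M.starProjection := by
  intro b x
  refine Submodule.eq_starProjection_of_mem_orthogonal
    (hM b _ (Submodule.starProjection_apply_mem M x)) ?_
  rw [← map_sub]
  intro u hu
  rw [← ContinuousLinearMap.adjoint_inner_left, ← hρ b]
  exact M.sub_starProjection_mem_orthogonal x _ (hM _ _ hu)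

variable {G : Type*} [AddCommGroup G] [Module ℂ G]

/-- An operator is determined by its values on the range of `e` and on the orthogonal complement
of that range. -/
lemma ContinuousLinearMap.eq_of_eqOn_range_of_eqOn_orthogonal [CompleteSpace H]
    (e : G →ₗ[ℂ] H) {S T : H →L[ℂ] K}
    (h : ∀ g, S (e g) = T (e g)) (h' : ∀ x, (∀ g, ⟪e g, x⟫_ℂ = 0) → S x = T x) : S = T := by
  ext x
  set M := (LinearMap.range e).topologicalClosure
  have : CompleteSpace M := (Submodule.isClosed_topologicalClosure _).completeSpace_coe
  have hM : ∀ y ∈ M, S y = T y := by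
    have : M ≤ LinearMap.eqLocus S.toLinearMap T.toLinearMap := by
      refine Submodule.topologicalClosure_minimal _ ?_ (isClosed_eq S.continuous T.continuous)
      rintro _ ⟨g, rfl⟩
      exact h g
    exact this
  have h1 := hM _ (M.starProjection_apply_mem x)
  have h2 : S (x - M.starProjection x) = T (x - M.starProjection x) := by
    refine h' _ fun g => ?_
    exact M.sub_starProjection_mem_orthogonal x _ (Submodule.le_topologicalClosure _ ⟨g, rfl⟩)
  rw [map_sub, map_sub, h1] at h2
  exact sub_left_injective h2

/-- An isometric correspondence `e g ↦ f g` that is compatible with two star families extends to a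
partial isometry intertwining them, with initial space the closure of the range of `e` and final
space the closure of the range of `f`. -/
lemma exists_isPartialIsometry_extension [Star ι] [CompleteSpace H] [CompleteSpace K]
    {ρ : ι → H →L[ℂ] H} {σ : ι → K →L[ℂ] K} (hρ : IsStarFamily ρ)
    (e : G →ₗ[ℂ] H) (f : G →ₗ[ℂ] K) (hef : ∀ g, ‖f g‖ = ‖e g‖)
    (hinv : ∀ b g, ∃ g', e g' = ρ b (e g) ∧ f g' = σ b (f g)) :
    ∃ V : H →L[ℂ] K, Intertwines ρ σ V ∧ IsPartialIsometry V ∧ (∀ g, V (e g) = f g) ∧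
      (∀ g, (V†) (f g) = e g) ∧ (∀ x, (∀ g, ⟪e g, x⟫_ℂ = 0) → V x = 0) ∧
      (∀ y, (∀ g, ⟪f g, y⟫_ℂ = 0) → (V†) y = 0) := by
  set M := (LinearMap.range e).topologicalClosure with hMdef
  have : CompleteSpace M := (Submodule.isClosed_topologicalClosure _).completeSpace_coe
  have heM : ∀ g, e g ∈ M := fun g => Submodule.le_topologicalClosure _ ⟨g, rfl⟩
  let e' : G →ₗ[ℂ] M := e.codRestrict M heM
  have hdense : DenseRange e' := by
    intro m
    rw [closure_subtype]
    have : (Subtype.val '' Set.range e' : Set H) = LinearMap.range e := by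
      ext x
      simp [e', Set.mem_image]
    rw [this]
    exact m.2
  have hbd : ∀ g, ‖f g‖ ≤ 1 * ‖e' g‖ := fun g => by
    rw [one_mul, hef]; rfl
  let V : H →L[ℂ] K := (f.extendOfNorm e') ∘L M.orthogonalProjectionOnto
  have hVe : ∀ g, V (e g) = f g := by
    intro g
    have h1 : M.orthogonalProjectionOnto (e g) = e' g :=
      Submodule.orthogonalProjectionOnto_mem_subspace_eq_self (e' g)
    change f.extendOfNorm e' (M.orthogonalProjectionOnto (e g)) = f g
    rw [h1]
    exact LinearMap.extendOfNorm_eq hdense ⟨1, hbd⟩ g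
  have hMo : ∀ x, (∀ g, ⟪e g, x⟫_ℂ = 0) → x ∈ Mᗮ := by
    intro x hx
    rw [hMdef, Submodule.orthogonal_closure]
    rintro _ ⟨g, rfl⟩
    exact hx g
  have hV0 : ∀ x, (∀ g, ⟪e g, x⟫_ℂ = 0) → V x = 0 := by
    intro x hx
    change f.extendOfNorm e' (M.orthogonalProjectionOnto x) = 0
    rw [Submodule.orthogonalProjectionOnto_apply_of_mem_orthogonal (hMo x hx),
      map_zero]
  have hinner : ∀ g g', ⟪f g, f g'⟫_ℂ = ⟪e g, e g'⟫_ℂ := by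
    intro g g'
    simp only [inner_eq_sum_norm_sq_div_four, ← map_add, ← map_sub, ← map_smul, hef]
  have hVf : ∀ g, (V†) (f g) = e g := by
    intro g
    suffices h : innerSL ℂ ((V†) (f g)) = innerSL ℂ (e g) by
      exact (innerSL_inj (𝕜 := ℂ)).1 h
    refine ContinuousLinearMap.eq_of_eqOn_range_of_eqOn_orthogonal e (fun g' => ?_) fun x hx => ?_
    · simp [ContinuousLinearMap.adjoint_inner_left, hVe, hinner]
    · simp [ContinuousLinearMap.adjoint_inner_left, hV0 x hx, hx g]
  have hpi : IsPartialIsometry V := by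
    have : V ∘L V† ∘L V = V := by
      refine ContinuousLinearMap.eq_of_eqOn_range_of_eqOn_orthogonal e (fun g => ?_) fun x hx => ?_
      · simp [hVe, hVf]
      · simp [hV0 x hx]
    exact fun x => congr($this x)
  refine ⟨V, fun b => ?_, hpi, hVe, hVf, hV0, fun y hy => ?_⟩
  · have : V ∘L ρ b = σ b ∘L V := by
      refine ContinuousLinearMap.eq_of_eqOn_range_of_eqOn_orthogonal e (fun g => ?_) fun x hx => ?_
      · obtain ⟨g', h1, h2⟩ := hinv b g
        simp [← h1, hVe, h2]
      · have : V (ρ b x) = 0 := hV0 _ fun g => by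
          obtain ⟨g', h1, -⟩ := hinv (star b) g
          rw [← ContinuousLinearMap.adjoint_inner_left, ← hρ b, ← h1]
          exact hx g'
        simp [hV0 x hx, this]
    exact fun x => congr($this x)
  · -- `V* y` is orthogonal to every `e g`, so it is killed by `V`, although `V V* = 1` on `ran V`.
    have h1 : V ((V†) y) = 0 := hV0 _ fun g => by
      rw [ContinuousLinearMap.adjoint_inner_right, hVe]
      exact hy g
    have h2 := hpi.adjoint y
    rwa [ContinuousLinearMap.adjoint_adjoint, h1, map_zero, eq_comm] at h2

/-- **Polar decomposition**: an intertwiner `T` has the same kernel as some intertwining partial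
isometry `V`, and so have the adjoints. -/
lemma Intertwines.exists_isPartialIsometry_ker_eq [Star ι] [CompleteSpace H] [CompleteSpace K]
    {ρ : ι → H →L[ℂ] H} {σ : ι → K →L[ℂ] K} (hρ : IsStarFamily ρ) (hσ : IsStarFamily σ)
    {T : H →L[ℂ] K} (hT : Intertwines ρ σ T) :
    ∃ V : H →L[ℂ] K, Intertwines ρ σ V ∧ IsPartialIsometry V ∧
      (∀ x, V x = 0 ↔ T x = 0) ∧ (∀ y, (V†) y = 0 ↔ (T†) y = 0) := by
  have hA : (0 : H →L[ℂ] H) ≤ T† ∘L T := by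
    rw [ContinuousLinearMap.nonneg_iff_isPositive]
    exact ContinuousLinearMap.isPositive_adjoint_comp_self T
  set P := CFC.sqrt (T† ∘L T)
  have hPsa : P† = P := (IsSelfAdjoint.of_nonneg (CFC.sqrt_nonneg _)).star_eq
  have hPP : ∀ x, P (P x) = (T†) (T x) := fun x =>
    congr($(CFC.sqrt_mul_sqrt_self _ hA) x)
  have hPc : ∀ b x, P (ρ b x) = ρ b (P x) := by
    intro b x
    have hc : Commute (T† ∘L T) (ρ b) := by
      ext z
      simp [hT b z, hT.adjoint hρ hσ b (T z)]
    exact congr($((hc.cfcₙ_nnreal _).eq) x)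
  have hnorm : ∀ x, ‖T x‖ = ‖P x‖ := by
    intro x
    rw [← sq_eq_sq₀ (norm_nonneg _) (norm_nonneg _)]
    have : ⟪T x, T x⟫_ℂ = ⟪P x, P x⟫_ℂ := by
      rw [← ContinuousLinearMap.adjoint_inner_right T, ← hPP,
        ← ContinuousLinearMap.adjoint_inner_left P, hPsa]
    rw [← inner_self_eq_norm_sq (𝕜 := ℂ), this, inner_self_eq_norm_sq]
  obtain ⟨V, hV, hpi, hVP, hVT, hV0, hV0'⟩ := exists_isPartialIsometry_extension (σ := σ) hρ
    P.toLinearMap T.toLinearMap hnorm (fun b x => ⟨ρ b x, hPc b x, hT b x⟩)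
  have hPT : ∀ x, P x = 0 ↔ T x = 0 := fun x => by
    rw [← norm_eq_zero, ← hnorm, norm_eq_zero]
  refine ⟨V, hV, hpi, fun x => ⟨fun h => ?_, fun h => hV0 x fun g => ?_⟩,
    fun y => ⟨fun h => ?_, fun h => hV0' y fun g => ?_⟩⟩
  · rw [← hPT]
    refine ext_inner_left ℂ fun z => ?_
    have : ⟪P z, x⟫_ℂ = 0 := by
      have := hVT z
      change (V†) (T z) = P z at this
      rw [← this, ContinuousLinearMap.adjoint_inner_left, h, inner_zero_right]
    rw [← ContinuousLinearMap.adjoint_inner_left, hPsa, this, inner_zero_right]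
  · change ⟪P g, x⟫_ℂ = 0
    rw [← hPsa, ContinuousLinearMap.adjoint_inner_left, (hPT x).2 h, inner_zero_right]
  · refine ext_inner_left ℂ fun z => ?_
    have := hVP z
    change V (P z) = T z at this
    rw [ContinuousLinearMap.adjoint_inner_right, ← this,
      ← ContinuousLinearMap.adjoint_inner_right, h, inner_zero_right, inner_zero_right]
  · change ⟪T g, y⟫_ℂ = 0
    rw [← ContinuousLinearMap.adjoint_inner_right, h, inner_zero_right]

/-! ### Maximal partial isometries -/

lemma IsPartialIsometry.norm_adjoint_apply_apply [CompleteSpace H] [CompleteSpace K]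
    {V : H →L[ℂ] K} (hV : IsPartialIsometry V) (x : H) : ‖(V†) (V x)‖ = ‖V x‖ := by
  rw [← sq_eq_sq₀ (norm_nonneg _) (norm_nonneg _), ← inner_self_eq_norm_sq (𝕜 := ℂ),
    ← inner_self_eq_norm_sq (𝕜 := ℂ), ContinuousLinearMap.adjoint_inner_left, hV]

/-- The graph of the partial isometry `V`, restricted to its initial space: the subspace of all
pairs `(V* V x, V x)`. -/
noncomputable def partialIsometryGraph [CompleteSpace H] [CompleteSpace K] (V : H →L[ℂ] K) :
    Submodule ℂ (H × K) :=
  LinearMap.range ((V† ∘L V).toLinearMap.prod V.toLinearMap)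

lemma mem_partialIsometryGraph [CompleteSpace H] [CompleteSpace K] {V : H →L[ℂ] K} {p : H × K} :
    p ∈ partialIsometryGraph V ↔ ∃ x, ((V†) (V x), V x) = p := Iff.rfl

/-- `G` is the graph of an isometric map between subspaces of `H` and `K` that are invariant under
the families `ρ` and `σ`, and this map is compatible with these families. -/
def IsIsometricGraph (ρ : ι → H →L[ℂ] H) (σ : ι → K →L[ℂ] K) (G : Submodule ℂ (H × K)) : Prop :=
  (∀ p ∈ G, ‖p.2‖ = ‖p.1‖) ∧ ∀ b, ∀ p ∈ G, (ρ b p.1, σ b p.2) ∈ G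

lemma isIsometricGraph_partialIsometryGraph [Star ι] [CompleteSpace H] [CompleteSpace K]
    {ρ : ι → H →L[ℂ] H} {σ : ι → K →L[ℂ] K} (hρ : IsStarFamily ρ) (hσ : IsStarFamily σ)
    {V : H →L[ℂ] K} (hV : Intertwines ρ σ V) (hVp : IsPartialIsometry V) :
    IsIsometricGraph ρ σ (partialIsometryGraph V) := by
  refine ⟨?_, ?_⟩
  · rintro _ ⟨x, rfl⟩
    exact (hVp.norm_adjoint_apply_apply x).symm
  · rintro b _ ⟨x, rfl⟩
    refine mem_partialIsometryGraph.2 ⟨ρ b x, ?_⟩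
    simp [hV b x, hV.adjoint hρ hσ b (V x)]

/-- Every intertwining partial isometry `v` extends to an intertwining partial isometry `w` that
admits no further extension. Maximality is expressed by `(1 - w w*) X (1 - w* w) = 0` for all
intertwiners `X`; of the extension property, only the inclusion of the final space of `v` in that
of `w` is recorded. -/
lemma Intertwines.exists_maximal_isPartialIsometry [Star ι] [CompleteSpace H] [CompleteSpace K]
    {ρ : ι → H →L[ℂ] H} {σ : ι → K →L[ℂ] K} (hρ : IsStarFamily ρ) (hσ : IsStarFamily σ)
    {v : H →L[ℂ] K} (hv : Intertwines ρ σ v) (hvp : IsPartialIsometry v) :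
    ∃ w : H →L[ℂ] K, Intertwines ρ σ w ∧ IsPartialIsometry w ∧
      (∀ y, (w†) y = 0 → (v†) y = 0) ∧
      ∀ X : H →L[ℂ] K, Intertwines ρ σ X → ∀ x y, w x = 0 → (w†) y = 0 → ⟪y, X x⟫_ℂ = 0 := by
  obtain ⟨G, hvG, hG⟩ := zorn_le_nonempty₀ {G | IsIsometricGraph ρ σ G} (fun c hc hchain y hy => by
    have hmem : ∀ p, p ∈ sSup c ↔ ∃ G ∈ c, p ∈ G := fun p =>
      Submodule.mem_sSup_of_directed ⟨y, hy⟩ hchain.directedOn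
    refine ⟨sSup c, ⟨fun p hp => ?_, fun b p hp => ?_⟩, fun z hz => le_sSup hz⟩
    · obtain ⟨G, hG, hpG⟩ := (hmem p).1 hp
      exact (hc hG).1 p hpG
    · obtain ⟨G, hG, hpG⟩ := (hmem p).1 hp
      exact (hmem _).2 ⟨G, hG, (hc hG).2 b p hpG⟩)
    (partialIsometryGraph v) (isIsometricGraph_partialIsometryGraph hρ hσ hv hvp)
  have hGiso : IsIsometricGraph ρ σ G := hG.prop
  obtain ⟨w, hw, hwp, hwe, hwf, -, -⟩ := exists_isPartialIsometry_extension (σ := σ) hρ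
    (LinearMap.fst ℂ H K ∘ₗ G.subtype) (LinearMap.snd ℂ H K ∘ₗ G.subtype)
    (fun g => hGiso.1 _ g.2) (fun b g => ⟨⟨_, hGiso.2 b _ g.2⟩, rfl, rfl⟩)
  replace hwe : ∀ p ∈ G, w p.1 = p.2 := fun p hp => hwe ⟨p, hp⟩
  replace hwf : ∀ p ∈ G, (w†) p.2 = p.1 := fun p hp => hwf ⟨p, hp⟩
  refine ⟨w, hw, hwp, fun y hy => ?_, fun X hX x y hx hy => ?_⟩
  · refine ext_inner_left ℂ fun z => ?_
    have h : w ((v†) (v z)) = v z := hwe _ (hvG (mem_partialIsometryGraph.2 ⟨z, rfl⟩))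
    rw [ContinuousLinearMap.adjoint_inner_right, ← h, ← ContinuousLinearMap.adjoint_inner_right,
      hy, inner_zero_right, inner_zero_right]
  -- A nonzero compression `Y` of `X` would have a polar part `V` by which `w` could be extended.
  let Y : H →L[ℂ] K := (.id ℂ K - w ∘L w†) ∘L X ∘L (.id ℂ H - w† ∘L w)
  have hYapp : ∀ z, Y z = X (z - (w†) (w z)) - w ((w†) (X (z - (w†) (w z)))) := fun z => rfl
  have hY : Intertwines ρ σ Y := by
    intro b z
    simp only [hYapp, hw b, (hw.adjoint hρ hσ) b, ← map_sub, hX b]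
  have hYw : ∀ y, Y ((w†) y) = 0 := by
    intro y
    have := hwp.adjoint y
    rw [ContinuousLinearMap.adjoint_adjoint] at this
    simp [hYapp, this]
  have hwY : ∀ z, (w†) (Y z) = 0 := by
    intro z
    have := hwp.adjoint (X (z - (w†) (w z)))
    rw [ContinuousLinearMap.adjoint_adjoint] at this
    rw [hYapp, map_sub, this, sub_self]
  have hYw' : ∀ x, (Y†) (w x) = 0 := by
    intro x
    refine ext_inner_right ℂ fun z => ?_
    rw [ContinuousLinearMap.adjoint_inner_left, ← ContinuousLinearMap.adjoint_inner_right, hwY,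
      inner_zero_right, inner_zero_left]
  obtain ⟨V, hV, hVp, hVY, hVY'⟩ := hY.exists_isPartialIsometry_ker_eq hρ hσ
  have hV1 : ∀ p ∈ G, V p.1 = 0 := fun p hp => by
    rw [← hwf p hp, hVY, hYw]
  have hV2 : ∀ p ∈ G, (V†) p.2 = 0 := fun p hp => by
    rw [← hwe p hp, hVY', hYw']
  have hVG := isIsometricGraph_partialIsometryGraph hρ hσ hV hVp
  have hsup : IsIsometricGraph ρ σ (G ⊔ partialIsometryGraph V) := by
    refine ⟨fun r hr => ?_, fun b r hr => ?_⟩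
    · obtain ⟨p, hp, _, ⟨z, rfl⟩, rfl⟩ := Submodule.mem_sup.1 hr
      change ‖p.2 + V z‖ = ‖p.1 + (V†) (V z)‖
      have h1 : ⟪p.2, V z⟫_ℂ = 0 := by
        rw [← ContinuousLinearMap.adjoint_inner_left, hV2 p hp, inner_zero_left]
      have h2 : ⟪p.1, (V†) (V z)⟫_ℂ = 0 := by
        rw [ContinuousLinearMap.adjoint_inner_right, hV1 p hp, inner_zero_left]
      rw [← sq_eq_sq₀ (norm_nonneg _) (norm_nonneg _), norm_add_sq (𝕜 := ℂ),
        norm_add_sq (𝕜 := ℂ), h1, h2, hGiso.1 p hp, hVp.norm_adjoint_apply_apply]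
    · obtain ⟨p, hp, q, hq, rfl⟩ := Submodule.mem_sup.1 hr
      exact Submodule.mem_sup.2 ⟨_, hGiso.2 b p hp, _, hVG.2 b q hq, by simp⟩
  have hVle : partialIsometryGraph V ≤ G := le_sup_right.trans (hG.2 hsup le_sup_left)
  have hYx : Y x = 0 := by
    rw [← hVY, ← hVp x]
    exact hV1 _ (hVle (mem_partialIsometryGraph.2 ⟨x, rfl⟩))
  have h : X x = w ((w†) (X x)) := by
    rw [hYapp, hx, map_zero, sub_zero] at hYx
    exact sub_eq_zero.1 hYx
  rw [h, ← ContinuousLinearMap.adjoint_inner_left, hy, inner_zero_left]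

/-- The Schröder–Bernstein step: if `w` is a maximal intertwining partial isometry from `H` to `K`
and `H` embeds in `K` by an isometric intertwiner `j`, then some isometric intertwiner from `H` to
`K` has a range containing that of `w`. -/
lemma Intertwines.exists_isometry_of_maximal [Star ι] [CompleteSpace H] [CompleteSpace K]
    {ρ : ι → H →L[ℂ] H} {σ : ι → K →L[ℂ] K} (hρ : IsStarFamily ρ) (hσ : IsStarFamily σ)
    {w j : H →L[ℂ] K} (hw : Intertwines ρ σ w) (hwp : IsPartialIsometry w)
    (hmax : ∀ X : H →L[ℂ] K, Intertwines ρ σ X →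
      ∀ x y, w x = 0 → (w†) y = 0 → ⟪y, X x⟫_ℂ = 0)
    (hj : Intertwines ρ σ j) (hjiso : ∀ x y, ⟪j x, j y⟫_ℂ = ⟪x, y⟫_ℂ) :
    ∃ W : H →L[ℂ] K, Intertwines ρ σ W ∧ (∀ x, (W†) (W x) = x) ∧
      ∀ y, (W†) y = 0 → (w†) y = 0 := by
  -- `W` is `j` on the closed span `M` of the iterates of `ker w` under `w* j`, and `w` on `Mᗮ`.
  let c : H →L[ℂ] H := w† ∘L j
  have hcapp : ∀ x, c x = (w†) (j x) := fun x => rfl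
  have hc : ∀ n : ℕ, Intertwines ρ ρ (c ^ n) := by
    intro n
    induction n with
    | zero => exact fun b x => rfl
    | succ n ih =>
      intro b x
      simp only [pow_succ', mul_apply_eq_comp, ih b x, hcapp, hj b _,
        hw.adjoint hρ hσ b _]
  set s : Set H := {z | ∃ (n : ℕ) (x : H), w x = 0 ∧ z = (c ^ n) x}
  set M := (Submodule.span ℂ s).topologicalClosure with hM
  have hMc : IsClosed (M : Set H) := Submodule.isClosed_topologicalClosure _
  have : CompleteSpace M := hMc.completeSpace_coe
  have hsM : s ⊆ M := Submodule.subset_span.trans (Submodule.le_topologicalClosure _)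
  have hkerM : ∀ x, w x = 0 → x ∈ M := fun x hx => hsM ⟨0, x, hx, rfl⟩
  have hmap : ∀ L : H →L[ℂ] H, (∀ x ∈ s, L x ∈ M) → ∀ x ∈ M, L x ∈ M := by
    intro L hL
    have : M ≤ M.comap L.toLinearMap :=
      Submodule.topologicalClosure_minimal _ (Submodule.span_le.2 hL) (hMc.preimage L.continuous)
    exact this
  have hMρ : ∀ b, ∀ x ∈ M, ρ b x ∈ M := by
    intro b
    refine hmap _ ?_
    rintro _ ⟨n, x, hx, rfl⟩
    exact hsM ⟨n, ρ b x, by rw [hw b, hx, map_zero], (hc n b x).symm⟩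
  have hcM : ∀ x ∈ M, c x ∈ M := by
    refine hmap _ ?_
    rintro _ ⟨n, x, hx, rfl⟩
    exact hsM ⟨n + 1, x, hx, by rw [pow_succ']; rfl⟩
  have hp := intertwines_starProjection hρ M hMρ
  set p := M.starProjection
  have hpM : ∀ x, p x ∈ M := fun x => M.starProjection_apply_mem x
  have hqM : ∀ x, x - p x ∈ Mᗮ := fun x => M.sub_starProjection_mem_orthogonal x
  let W : H →L[ℂ] K := j ∘L p + w ∘L (.id ℂ H - p)
  have hWapp : ∀ x, W x = j (p x) + w (x - p x) := fun x => rfl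
  have hWM : ∀ x ∈ M, W x = j x := by
    intro x hx
    rw [hWapp, Submodule.starProjection_eq_self_iff.2 hx, sub_self, map_zero, add_zero]
  have hWo : ∀ x ∈ Mᗮ, W x = w x := by
    intro x hx
    have : p x = 0 := (M.starProjection_apply_eq_zero_iff).2 hx
    rw [hWapp, this, map_zero, zero_add, sub_zero]
  have hwo : ∀ u ∈ Mᗮ, (w†) (w u) = u := by
    intro u hu
    have hn : w (u - (w†) (w u)) = 0 := by rw [map_sub, hwp, sub_self]
    have h : ⟪u - (w†) (w u), u - (w†) (w u)⟫_ℂ = 0 := by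
      rw [inner_sub_right, (hu _ (hkerM _ hn)), ContinuousLinearMap.adjoint_inner_right, hn,
        inner_zero_left, sub_zero]
    exact (sub_eq_zero.1 (inner_self_eq_zero.1 h)).symm
  have hcross : ∀ u ∈ Mᗮ, ∀ m ∈ M, ⟪j m, w u⟫_ℂ = 0 := by
    intro u hu m hm
    rw [← ContinuousLinearMap.adjoint_inner_left]
    exact hu _ (hcM m hm)
  refine ⟨W, fun b x => ?_, fun x => ?_, fun y hy => ?_⟩
  · rw [hWapp, hWapp, hp b, hj b, ← map_sub, hw b, map_add]
  · refine ext_inner_left ℂ fun z => ?_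
    have h1 : ⟪p z, x - p x⟫_ℂ = 0 := hqM x _ (hpM z)
    have h2 : ⟪z - p z, p x⟫_ℂ = 0 := Submodule.inner_left_of_mem_orthogonal (hpM x) (hqM z)
    have h3 : ⟪w (z - p z), j (p x)⟫_ℂ = 0 := by
      rw [← inner_conj_symm, hcross _ (hqM z) _ (hpM x), map_zero]
    have h4 : ⟪w (z - p z), w (x - p x)⟫_ℂ = ⟪z - p z, x - p x⟫_ℂ := by
      rw [← ContinuousLinearMap.adjoint_inner_right, hwo _ (hqM x)]
    have h5 : ⟪p z + (z - p z), p x + (x - p x)⟫_ℂ = ⟪z, x⟫_ℂ := by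
      rw [add_sub_cancel, add_sub_cancel]
    rw [ContinuousLinearMap.adjoint_inner_right, ← h5, hWapp, hWapp]
    simp only [inner_add_left, inner_add_right, hjiso, hcross _ (hqM x) _ (hpM z), h1, h2, h3, h4]
  · have hWy : ∀ x, ⟪W x, y⟫_ℂ = 0 := fun x => by
      rw [← ContinuousLinearMap.adjoint_inner_right, hy, inner_zero_right]
    have hyM : (w†) y ∈ M := by
      rw [← Submodule.orthogonal_orthogonal M]
      intro u hu
      rw [ContinuousLinearMap.adjoint_inner_right, ← hWo u hu, hWy]
    have hyo : (w†) y ∈ Mᗮ := by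
      rw [hM, Submodule.orthogonal_closure, Submodule.mem_orthogonal]
      intro u hu
      refine Submodule.span_induction ?_ (inner_zero_left _)
        (fun a b _ _ ha hb => by rw [inner_add_left, ha, hb, add_zero])
        (fun a x _ hx => by rw [inner_smul_left, hx, mul_zero]) hu
      rintro _ ⟨n, x, hx, rfl⟩
      rw [ContinuousLinearMap.adjoint_inner_right]
      cases n with
      | zero =>
        change ⟪w x, y⟫_ℂ = 0
        rw [hx, inner_zero_left]
      | succ n =>
        set r := (c ^ n) x
        -- By maximality, `j r` lies in the final space of `w`.
        have hjr : w ((w†) (j r)) = j r := by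
          have hz : (w†) (j r - w ((w†) (j r))) = 0 := by
            have := hwp.adjoint (j r)
            rw [ContinuousLinearMap.adjoint_adjoint] at this
            rw [map_sub, this, sub_self]
          have h1 : ⟪j r - w ((w†) (j r)), j r⟫_ℂ = 0 :=
            hmax (j ∘L c ^ n) (fun b x => by simp [hc n b x, hj b _]) x _ hx hz
          have h : ⟪j r - w ((w†) (j r)), j r - w ((w†) (j r))⟫_ℂ = 0 := by
            rw [inner_sub_right, h1, ← ContinuousLinearMap.adjoint_inner_left, hz,
              inner_zero_left, sub_zero]
          exact (sub_eq_zero.1 (inner_self_eq_zero.1 h)).symm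
        have h : w ((c ^ (n + 1)) x) = j r := by
          rw [pow_succ', mul_apply_eq_comp, hcapp, hjr]
        rw [h, ← hWM r (hsM ⟨n, x, hx, rfl⟩), hWy]
    exact inner_self_eq_zero.1 (hyo _ hyM)

end Intertwiners

/-! ### Factorization of columns over a von Neumann algebra -/

section Column

variable {H : Type*} [NormedAddCommGroup H] [InnerProductSpace ℂ H]

/-- The column `x ↦ (S x, T x)`, with values in the Hilbert space direct sum of two copies of
`H`. -/
noncomputable def columnOperator (S T : H →L[ℂ] H) : H →L[ℂ] WithLp 2 (H × H) :=
  (WithLp.prodContinuousLinearEquiv 2 ℂ H H).symm.toContinuousLinearMap ∘L S.prod T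

lemma columnOperator_apply (S T : H →L[ℂ] H) (x : H) :
    columnOperator S T x = WithLp.toLp 2 (S x, T x) := rfl

/-- The amplification `(x, y) ↦ (b x, b y)` of an operator `b` to the Hilbert space direct sum of
two copies of `H`. -/
noncomputable def diagOperator (b : H →L[ℂ] H) : WithLp 2 (H × H) →L[ℂ] WithLp 2 (H × H) :=
  (WithLp.prodContinuousLinearEquiv 2 ℂ H H).symm.toContinuousLinearMap ∘L b.prodMap b ∘L
    (WithLp.prodContinuousLinearEquiv 2 ℂ H H).toContinuousLinearMap

lemma diagOperator_apply (b : H →L[ℂ] H) (z : WithLp 2 (H × H)) :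
    diagOperator b z = WithLp.toLp 2 (b z.fst, b z.snd) := rfl

lemma adjoint_diagOperator [CompleteSpace H] (b : H →L[ℂ] H) :
    (diagOperator b)† = diagOperator (b†) := by
  symm
  rw [ContinuousLinearMap.eq_adjoint_iff]
  intro y z
  simp [WithLp.prod_inner_apply, diagOperator_apply, ContinuousLinearMap.adjoint_inner_left]

/-- Every column with entries in a von Neumann algebra `R` is the product of an isometric column
with entries in `R` and an element of `R`. -/
lemma VonNeumannAlgebra.exists_column_factorization [CompleteSpace H] (R : VonNeumannAlgebra H)
    (S T : R) : ∃ V W X : R, star V * V + star W * W = 1 ∧ V * X = S ∧ W * X = T := by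
  let ρ : R.commutant → H →L[ℂ] H := fun b => b
  let σ : R.commutant → WithLp 2 (H × H) →L[ℂ] WithLp 2 (H × H) := fun b => diagOperator (b : _)
  have hρ : IsStarFamily ρ := fun b => rfl
  have hσ : IsStarFamily σ := fun b => (adjoint_diagOperator _).symm
  have hR : ∀ A : H →L[ℂ] H, A ∈ R ↔ ∀ b : R.commutant, ∀ x, A (ρ b x) = ρ b (A x) := by
    intro A
    conv_lhs => rw [← R.commutant_commutant, VonNeumannAlgebra.mem_commutant_iff]
    exact ⟨fun h b x => congr($(h b b.2) x).symm, fun h g hg => by ext x; exact (h ⟨g, hg⟩ x).symm⟩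
  let C := columnOperator (S : H →L[ℂ] H) (T : H →L[ℂ] H)
  have hC : Intertwines ρ σ C := by
    intro b x
    simp only [C, columnOperator_apply, (hR S).1 S.2 b x, (hR T).1 T.2 b x]
    rfl
  let j := columnOperator (.id ℂ H) (0 : H →L[ℂ] H)
  have hj : Intertwines ρ σ j := by
    intro b x
    simp [j, ρ, σ, columnOperator_apply, diagOperator_apply]
  have hjiso : ∀ x y, ⟪j x, j y⟫_ℂ = ⟪x, y⟫_ℂ := by
    intro x y
    simp [j, columnOperator_apply, WithLp.prod_inner_apply]
  obtain ⟨v, hv, hvp, -, hvC⟩ := hC.exists_isPartialIsometry_ker_eq hρ hσ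
  obtain ⟨w, hw, hwp, hwv, hmax⟩ := hv.exists_maximal_isPartialIsometry hρ hσ hvp
  obtain ⟨U, hU, hUU, hUw⟩ := hw.exists_isometry_of_maximal hρ hσ hwp hmax hj hjiso
  have hUC : ∀ x, U ((U†) (C x)) = C x := by
    intro x
    have hz : (U†) (C x - U ((U†) (C x))) = 0 := by rw [map_sub, hUU, sub_self]
    have h1 : (C†) (C x - U ((U†) (C x))) = 0 := (hvC _).1 (hwv _ (hUw _ hz))
    have h : ⟪C x - U ((U†) (C x)), C x - U ((U†) (C x))⟫_ℂ = 0 := by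
      rw [inner_sub_right, ← ContinuousLinearMap.adjoint_inner_left,
        ← ContinuousLinearMap.adjoint_inner_left, hz, h1, inner_zero_left, inner_zero_left,
        sub_zero]
    exact (sub_eq_zero.1 (inner_self_eq_zero.1 h)).symm
  let U₁ : H →L[ℂ] H := WithLp.fstL 2 ℂ H H ∘L U
  let U₂ : H →L[ℂ] H := WithLp.sndL 2 ℂ H H ∘L U
  have hU₁ : U₁ ∈ R := (hR _).2 fun b x => congr(($(hU b x)).fst)
  have hU₂ : U₂ ∈ R := (hR _).2 fun b x => congr(($(hU b x)).snd)
  have hX : U† ∘L C ∈ R := (hR _).2 fun b x => by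
    simp only [ContinuousLinearMap.comp_apply, hC b x, hU.adjoint hρ hσ b (C x)]
  refine ⟨⟨U₁, hU₁⟩, ⟨U₂, hU₂⟩, ⟨U† ∘L C, hX⟩, Subtype.ext ?_, Subtype.ext ?_, Subtype.ext ?_⟩
  · change U₁† ∘L U₁ + U₂† ∘L U₂ = .id ℂ H
    ext x
    refine ext_inner_left ℂ fun z => ?_
    have h : ⟪U z, U x⟫_ℂ = ⟪z, x⟫_ℂ := by
      rw [← ContinuousLinearMap.adjoint_inner_right, hUU]
    rw [WithLp.prod_inner_apply] at h
    simp only [add_apply, ContinuousLinearMap.comp_apply,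
      ContinuousLinearMap.id_apply, inner_add_right, ContinuousLinearMap.adjoint_inner_right]
    exact h
  · ext x
    exact congr(($(hUC x)).fst)
  · ext x
    exact congr(($(hUC x)).snd)

end Column

/-! ### From segments to polytopes -/

section Convexity

variable {A E : Type*} [CStarAlgebra A] [NormedAddCommGroup E] [Module A E] [Module Aᵐᵒᵖ E]
  {S : Set E}

lemma IsCStarConvex.isPseudoCStarConvex (hS : IsCStarConvex A S) : IsPseudoCStarConvex A S := by
  rintro x hx y hy _ ⟨T, hT, rfl⟩
  exact hS 2 one_le_two _ (fun i => by fin_cases i <;> assumption) T hT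

lemma IsPseudoCStarConvex.add_mem (hS : IsPseudoCStarConvex A S) {x y : E} (hx : x ∈ S)
    (hy : y ∈ S) {V W : A} (h : star V * V + star W * W = 1) :
    star V •> x <• V + star W •> y <• W ∈ S :=
  hS x hx y hy ⟨![V, W], by simpa using h, by simp⟩

/-- If columns over `A` factor through isometric columns, then the first two terms of an `A`-convex
combination can be merged into one, the merged point lying on an `A`-segment. -/
lemma IsPseudoCStarConvex.isCStarConvex_of_column_factorization [SMulCommClass A Aᵐᵒᵖ E]
    (hS : IsPseudoCStarConvex A S)
    (hA : ∀ S T : A, ∃ V W X : A, star V * V + star W * W = 1 ∧ V * X = S ∧ W * X = T) :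
    IsCStarConvex A S := by
  intro n hn
  induction n, hn using Nat.le_induction with
  | base =>
    intro x hx T hT
    simp only [Fin.sum_univ_one] at hT ⊢
    simpa using hS.add_mem (hx 0) (hx 0) (V := T 0) (W := 0) (by simpa using hT)
  | succ n hn ih =>
    obtain ⟨n, rfl⟩ := Nat.exists_eq_add_of_le' hn
    intro x hx T hT
    obtain ⟨V, W, X, hVW, hV, hW⟩ := hA (T 0) (T 1)
    have key := ih
      (Fin.cons (star V •> x 0 <• V + star W •> x 1 <• W) fun i : Fin n => x i.succ.succ)
      (Fin.cases (hS.add_mem (hx 0) (hx 1) hVW) fun i => hx _)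
      (Fin.cons X fun i : Fin n => T i.succ.succ) ?_
    · rw [Fin.sum_univ_succ] at key ⊢
      rw [Fin.sum_univ_succ]
      convert key using 1
      simp only [Fin.cons_zero, Fin.cons_succ, Fin.succ_zero_eq_one, ← hV, ← hW, star_mul,
        MulOpposite.op_mul, mul_smul, smul_add, add_assoc]
      simp only [smul_comm (_ : A) (_ : Aᵐᵒᵖ)]
    · rw [Fin.sum_univ_succ, Fin.sum_univ_succ] at hT
      rw [Fin.sum_univ_succ, ← hT, ← add_assoc]
      simp only [Fin.cons_zero, Fin.cons_succ, Fin.succ_zero_eq_one]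
      congr 1
      rw [← hV, ← hW, star_mul, star_mul]
      calc star X * X = star X * (star V * V + star W * W) * X := by rw [hVW, mul_one]
        _ = _ := by noncomm_ring

end Convexity

theorem mainTheorem2 {H : Type*} [NormedAddCommGroup H] [InnerProductSpace ℂ H] [CompleteSpace H]
    (R : VonNeumannAlgebra H) {E : Type*} [NormedAddCommGroup E] [NormedSpace ℂ E]
    [CompleteSpace E] [Module R E] [Module (↥R)ᵐᵒᵖ E] [HilbertBimodule R E] (S : Set E) :
    IsCStarConvex R S ↔ IsPseudoCStarConvex R S :=
  ⟨fun h => h.isPseudoCStarConvex,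
    fun h => h.isCStarConvex_of_column_factorization R.exists_column_factorization⟩
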